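/- Notation: $\mathbb{N}=\{0,1,2,\dots\}$, $[n]=\{1,\dots,n\}$, and $\|t\|=\min_{m\in\mathbb{Z}}|t-m|$. For $\alpha\in\mathbb{R}$ and $\varepsilon:\mathbb{N}\to\mathbb{R}$ put $$\mathcal{A}=\mathcal{A}_\varepsilon(\alpha)=\{n\in\mathbb{N} : \|\alpha n^2\|<\varepsilon(n)\},\qquad k\mathcal{A}=\{n_1+\dots+n_k : n_i\in\mathcal{A}\}.$$ The set $\mathcal{A}$ is an \emph{almost basis of order $k$} if $k\mathcal{A}$ has asymptotic density $1$, i.e. $\lim_{n\to\infty}|k\mathcal{A}\cap[n]|/n=1$; it is a \emph{basis of order $k$} if $k\mathcal{A}$ contains all sufficiently large integers. The \emph{irrationality measure} $\mu(\alpha)\in[-\infty,\infty]$ is the infimum of all real $\mu$ such that for every $\delta>0$ there is $c>0$ with $|\alpha-p/q|\ge c\,q^{-\mu-\delta}$ for all integers $p$ and $q\ge 1$ with $\alpha\ne p/q$ (and $\mu(\alpha)=\infty$ if there is no such $\mu$). The number $\alpha$ is \emph{badly approximable} if there is $c>0$ with $|\alpha-p/q|\ge c\,q^{-2}$ for all integers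 $p$ and $q\ge1$. \textbf{Theorem.} Let $\alpha$ be an irrational real number. (1) There is a strictly decreasing sequence $\varepsilon_\alpha(n)\to 0$ such that for every $\varepsilon$ with $\varepsilon(n)\ge\varepsilon_\alpha(n)$ for all $n$, the set $\mathcal{A}_\varepsilon(\alpha)$ is an almost basis of order $2$ and a basis of order $3$. (2) If $\mu(\alpha)<\infty$, then there is a constant $c>0$ depending only on $\alpha$ such that for every $\varepsilon:\mathbb{N}\to(0,\infty)$ with $\frac{\log(1/\varepsilon(n))}{\log n}\to 0$ as $n\to\infty$, the set $\mathcal{A}_\varepsilon(\alpha)$ is an almost basis of order $2$ and a basis of order $3$, and $$|[T]\setminus 2\mathcal{A}_\varepsilon(\alpha)|\le C\,T^{1-c}\qquad\text{for all integers } T\ge 1,$$ where $C$ depends only on $\alpha$ and $\varepsilon$. (3) If $\alpha$ is badly approximable and $\varepsilon_0>0$, then there is a constant $C$ depending only on $\alpha$ and $\varepsilon_0$ such that for every $\varepsilon$ with $\varepsilon(n)\ge\varepsilon_0$ for all $n$, the set $\mathcal{A}_\varepsilon(\alpha)$ is an almost basis of order $2$ and a basis of order $3$, and $$|[T]\setminus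 2\mathcal{A}_\varepsilon(\alpha)|\le C\log T\qquad\text{for all integers } T\ge 2.$$ -/

import Mathlib

open Filter Topology

noncomputable section

/-- The distance `‖x‖ = min_{n ∈ ℤ} |x - n|` from a real number to the nearest integer. -/
def nearestIntDist (x : ℝ) : ℝ := |x - round x|

/-- The set `A = {n ∈ ℕ : ‖α n²‖ < ε(n)}`. -/
def quadSet (ε : ℕ → ℝ) (α : ℝ) : Set ℕ :=
  {n | nearestIntDist (α * (n : ℝ) ^ 2) < ε n}

/-- The `k`-fold sumset `kA = {n₁ + ⋯ + n_k : n_i ∈ A}`. -/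
def kSumset (k : ℕ) (A : Set ℕ) : Set ℕ :=
  {n | ∃ f : Fin k → ℕ, (∀ i, f i ∈ A) ∧ ∑ i, f i = n}

/-- `A` is a basis of order `k`: `kA` contains all sufficiently large integers. -/
def IsBasisOfOrder (k : ℕ) (A : Set ℕ) : Prop :=
  ∀ᶠ n in atTop, n ∈ kSumset k A

/-- `B` has asymptotic density `d`: the limit of `|B ∩ {1, …, n}| / n` exists and equals `d`. -/
def HasAsymptoticDensity (B : Set ℕ) (d : ℝ) : Prop :=
  Tendsto (fun n : ℕ => ((B ∩ Set.Icc 1 n).ncard : ℝ) / (n : ℝ)) atTop (𝓝 d)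

/-- `A` is an almost basis of order `k`: `kA` has asymptotic density `1`. -/
def IsAlmostBasisOfOrder (k : ℕ) (A : Set ℕ) : Prop :=
  HasAsymptoticDensity (kSumset k A) 1

/-- The number of elements of `{1, …, T}` that do not lie in `2A`. -/
def exceptionCount (A : Set ℕ) (T : ℕ) : ℕ :=
  (Set.Icc 1 T \ kSumset 2 A).ncard

/-- `μ` is admissible for `α`: for every `δ > 0` there is `c > 0` such that
`|α - p/q| ≥ c / q^(μ + δ)` for all rationals `p/q ≠ α`. -/
def IsIrrationalityBound (α μ : ℝ) : Prop :=
  ∀ δ : ℝ, 0 < δ → ∃ c : ℝ, 0 < c ∧ ∀ (p : ℤ) (q : ℕ), 0 < q → α ≠ (p : ℝ) / (q : ℝ) →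
    c / (q : ℝ) ^ (μ + δ) ≤ |α - (p : ℝ) / (q : ℝ)|

/-- The irrationality measure of `α`, an extended real number: the infimum of all admissible
exponents, equal to `⊤` if there is none. -/
def irrationalityMeasure (α : ℝ) : EReal :=
  sInf ((fun μ : ℝ => (μ : EReal)) '' {μ : ℝ | IsIrrationalityBound α μ})

/-- `α` is badly approximable: `|α - p/q| ≥ c / q²` for all `p/q`, with `c > 0` constant. -/
def IsBadlyApproximable (α : ℝ) : Prop :=
  ∃ c : ℝ, 0 < c ∧ ∀ (p : ℤ) (q : ℕ), 0 < q →
    c / (q : ℝ) ^ 2 ≤ |α - (p : ℝ) / (q : ℝ)|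

end

/-! To write N = n + (N - n) with both terms in A, the points (αn², α(N-n)²), 0 ≤ n ≤ N, must meet a
small box about 0 in the two-dimensional torus. Testing with a nonnegative trigonometric polynomial
of degree K (`exists_nearestIntDist_lt_of_sums_small`) reduces this to the smallness of the
exponential sums of frequency (j, l) ≠ 0. Their phase is (j+l)αn² - 2lαNn plus a constant. If j + l
≠ 0, Weyl's inequality (`norm_sq_quadratic_sum_le`) suffices once N is large in terms of K and of
the approximations to α of small denominator. If j + l = 0, the sum is geometric, and small unless
2lαN is very close to an integer. These linear resonances, 1 ≤ l ≤ K, are the only obstruction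
(`mem_kSumset_two_of_diophantine`).

Resonances are rare: if two integers at distance d resonate with the same l, then 2ldα is nearly an
integer, so d cannot be small. Hence there are O(N/K) exceptions up to N
(`GoodLevel.exceptionCount_le`). For order three, take a < b in A: if N - a and N - b were both
resonant, eliminating N would make 2lk(b-a)α nearly an integer, which is impossible for large N
(`GoodLevel.mem_kSumset_two_or`).

It remains to choose K. It tends to infinity with N at a rate dictated by α in part (1), and is a
power of N in part (2). In part (3) a fixed K is enough for the count: the resonances of each l then
grow geometrically, so there are O(log T) of them. -/

noncomputable section

/-! ### Additive characters and the distance to the nearest integer -/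

/-- The additive character `x ↦ exp (2πix)`. -/
def unitExp (x : ℝ) : ℂ := Complex.exp (((2 * Real.pi * x : ℝ) : ℂ) * Complex.I)

lemma unitExp_add (x y : ℝ) : unitExp (x + y) = unitExp x * unitExp y := by
  simp only [unitExp, ← Complex.exp_add]
  congr 1
  push_cast
  ring

lemma norm_unitExp (x : ℝ) : ‖unitExp x‖ = 1 := Complex.norm_exp_ofReal_mul_I _

lemma unitExp_zero : unitExp 0 = 1 := by simp [unitExp]

lemma unitExp_nat_mul (n : ℕ) (x : ℝ) : unitExp (n * x) = unitExp x ^ n := by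
  rw [unitExp, unitExp, ← Complex.exp_nat_mul]
  congr 1
  push_cast
  ring

lemma conj_unitExp (x : ℝ) : (starRingEnd ℂ) (unitExp x) = unitExp (-x) := by
  rw [unitExp, unitExp, ← Complex.exp_conj, map_mul, Complex.conj_ofReal, Complex.conj_I]
  congr 1
  push_cast
  ring

lemma nearestIntDist_nonneg (x : ℝ) : 0 ≤ nearestIntDist x := abs_nonneg _

lemma nearestIntDist_le_half (x : ℝ) : nearestIntDist x ≤ 1 / 2 := abs_sub_round x

lemma nearestIntDist_le_abs_sub (x : ℝ) (m : ℤ) : nearestIntDist x ≤ |x - m| := round_le x m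

lemma nearestIntDist_neg (x : ℝ) : nearestIntDist (-x) = nearestIntDist x := by
  have key : ∀ y : ℝ, nearestIntDist (-y) ≤ nearestIntDist y := fun y => by
    refine (nearestIntDist_le_abs_sub (-y) (-round y)).trans_eq ?_
    rw [nearestIntDist, ← abs_neg]
    congr 1
    push_cast
    ring
  refine le_antisymm (key x) ?_
  simpa using key (-x)

lemma nearestIntDist_sub_le (x y : ℝ) :
    nearestIntDist (x - y) ≤ nearestIntDist x + nearestIntDist y := by
  refine (nearestIntDist_le_abs_sub (x - y) (round x - round y)).trans ?_
  refine le_trans (le_of_eq ?_) (abs_sub (x - round x) (y - round y))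
  congr 1
  push_cast
  ring

lemma nearestIntDist_nat_mul_le (n : ℕ) (x : ℝ) :
    nearestIntDist (n * x) ≤ n * nearestIntDist x := by
  refine (nearestIntDist_le_abs_sub (n * x) (n * round x)).trans_eq ?_
  rw [nearestIntDist, ← abs_of_nonneg (Nat.cast_nonneg n : (0 : ℝ) ≤ n), ← abs_mul,
    abs_of_nonneg (Nat.cast_nonneg n : (0 : ℝ) ≤ n)]
  congr 1
  push_cast
  ring

lemma nearestIntDist_int_mul (s : ℤ) (x : ℝ) :
    nearestIntDist (s * x) = nearestIntDist (s.natAbs * x) := by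
  rcases abs_choice (s : ℝ) with h | h
  · rw [Nat.cast_natAbs, Int.cast_abs, h]
  · rw [Nat.cast_natAbs, Int.cast_abs, h, neg_mul, nearestIntDist_neg]

lemma nearestIntDist_pos {x : ℝ} (hx : Irrational x) : 0 < nearestIntDist x :=
  abs_pos.2 (sub_ne_zero.2 (hx.ne_int _))

lemma two_mul_nearestIntDist_le_abs_sin (x : ℝ) :
    2 * nearestIntDist x ≤ |Real.sin (Real.pi * x)| := by
  have h1 : |Real.sin (Real.pi * x)| = |Real.sin (Real.pi * (x - round x))| := by
    have : Real.pi * (x - round x) = Real.pi * x - round x * Real.pi := by ring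
    rw [this, Real.sin_sub_int_mul_pi, abs_mul, abs_zpow]
    simp
  have h2 := Real.mul_abs_le_abs_sin (x := Real.pi * (x - round x)) (by
    rw [abs_mul, abs_of_pos Real.pi_pos]
    have := abs_sub_round x
    nlinarith [Real.pi_pos])
  rw [abs_mul, abs_of_pos Real.pi_pos] at h2
  rw [h1]
  refine le_trans (le_of_eq ?_) h2
  rw [nearestIntDist]
  field_simp

lemma cos_sq_le_of_le_nearestIntDist {x e : ℝ} (he : 0 ≤ e) (hx : e ≤ nearestIntDist x) :
    Real.cos (Real.pi * x) ^ 2 ≤ 1 - 4 * e ^ 2 := by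
  have h := two_mul_nearestIntDist_le_abs_sin x
  rw [Real.cos_sq', ← sq_abs (Real.sin _)]
  nlinarith

lemma four_mul_nearestIntDist_le_norm (x : ℝ) : 4 * nearestIntDist x ≤ ‖unitExp x - 1‖ := by
  have h : ‖unitExp x - 1‖ = 2 * |Real.sin (Real.pi * x)| := by
    rw [unitExp, mul_comm _ Complex.I, Complex.norm_exp_I_mul_ofReal_sub_one, Real.norm_eq_abs,
      abs_mul, abs_of_pos (by norm_num : (0 : ℝ) < 2)]
    congr 3
    ring
  rw [h]
  linarith [two_mul_nearestIntDist_le_abs_sin x]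

lemma norm_sum_unitExp_le_card {ι : Type*} (s : Finset ι) (f : ι → ℝ) :
    ‖∑ i ∈ s, unitExp (f i)‖ ≤ s.card := by
  refine (norm_sum_le _ _).trans ?_
  simp [norm_unitExp]

/-- Multiplied out, so that integral x needs no separate case. -/
lemma norm_geom_sum_unitExp_mul_le (x : ℝ) (m : ℕ) :
    ‖∑ n ∈ Finset.range m, unitExp (n * x)‖ * (2 * nearestIntDist x) ≤ 1 := by
  have h1 : ‖∑ n ∈ Finset.range m, unitExp (n * x)‖ * ‖unitExp x - 1‖ ≤ 2 := by
    rw [← norm_mul]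
    simp_rw [unitExp_nat_mul]
    rw [geom_sum_mul]
    refine (norm_sub_le _ _).trans ?_
    rw [norm_pow, norm_unitExp]
    norm_num
  have h2 := four_mul_nearestIntDist_le_norm x
  nlinarith [norm_nonneg (∑ n ∈ Finset.range m, unitExp (n * x))]

/-! ### Weyl differencing and quadratic exponential sums -/

lemma sum_range_sum_range_eq_sum_shift {M : Type*} [AddCommMonoid M] (F : ℕ → ℕ → M) (m : ℕ) :
    ∑ a ∈ Finset.range m, ∑ b ∈ Finset.range a, F a b =
      ∑ h ∈ Finset.range m, ∑ b ∈ Finset.range (m - (h + 1)), F (h + 1 + b) b := by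
  have h1 : ∀ a, ∑ b ∈ Finset.range a, F a b = ∑ h ∈ Finset.range a, F a (a - 1 - h) :=
    fun a => (Finset.sum_range_reflect (F a) a).symm
  simp_rw [h1]
  rw [Finset.sum_comm' (t' := Finset.range m) (s' := fun h => Finset.Ico (h + 1) m)]
  · refine Finset.sum_congr rfl fun h _ => ?_
    rw [Finset.sum_Ico_eq_sum_range]
    refine Finset.sum_congr rfl fun b _ => ?_
    congr 1
    omega
  · intro a h
    simp only [Finset.mem_range, Finset.mem_Ico]
    omega

/-- Expand the square: the off-diagonal terms come in conjugate pairs, and are grouped by the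
difference h + 1 of the two indices. -/
lemma norm_sq_sum_range_le (f : ℕ → ℂ) (m : ℕ) :
    ‖∑ n ∈ Finset.range m, f n‖ ^ 2 ≤ ∑ n ∈ Finset.range m, ‖f n‖ ^ 2 +
      2 * ∑ h ∈ Finset.range m,
        ‖∑ b ∈ Finset.range (m - (h + 1)), f (h + 1 + b) * (starRingEnd ℂ) (f b)‖ := by
  have key : ‖∑ n ∈ Finset.range m, f n‖ ^ 2 = ∑ n ∈ Finset.range m, ‖f n‖ ^ 2 +
      2 * (∑ a ∈ Finset.range m, ∑ b ∈ Finset.range a, f a * (starRingEnd ℂ) (f b)).re := by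
    induction m with
    | zero => simp
    | succ m ih =>
      rw [Finset.sum_range_succ, Finset.sum_range_succ, Finset.sum_range_succ,
        ← Complex.normSq_eq_norm_sq, Complex.normSq_add, Complex.normSq_eq_norm_sq,
        Complex.normSq_eq_norm_sq, ih, ← Finset.mul_sum, ← map_sum, Complex.add_re]
      have : ((∑ x ∈ Finset.range m, f x) * (starRingEnd ℂ) (f m)).re =
          (f m * (starRingEnd ℂ) (∑ x ∈ Finset.range m, f x)).re := by
        simp only [Complex.mul_re, Complex.conj_re, Complex.conj_im]
        ring
      rw [this]
      ring
  rw [key, sum_range_sum_range_eq_sum_shift (fun a b => f a * (starRingEnd ℂ) (f b))]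
  have h1 := Complex.re_le_norm (∑ h ∈ Finset.range m, ∑ b ∈ Finset.range (m - (h + 1)),
    f (h + 1 + b) * (starRingEnd ℂ) (f b))
  have h2 := norm_sum_le (Finset.range m) (fun h => ∑ b ∈ Finset.range (m - (h + 1)),
    f (h + 1 + b) * (starRingEnd ℂ) (f b))
  linarith

/-- Integers with `‖xh‖` small are separated when no small multiple of `x` is close to `ℤ`. -/
lemma card_filter_nearestIntDist_lt_le {x δ : ℝ} {D : ℕ} (hD : 0 < D)
    (h : ∀ d : ℕ, 0 < d → d ≤ D → 2 * δ ≤ nearestIntDist (d * x)) (c m : ℕ) :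
    ((Finset.range m).filter fun n : ℕ => nearestIntDist ((n + c : ℕ) * x) < δ).card ≤ m / D + 1 := by
  rw [← Finset.card_range (m / D + 1)]
  -- At most one element per block of length D: two in one block would differ by some d < D with
  -- ‖dx‖ < 2δ.
  refine Finset.card_le_card_of_injOn (fun n => n / D) ?_ ?_
  · intro n hn
    simp only [Finset.coe_filter, Finset.mem_range, Set.mem_ofPred_eq] at hn
    simp only [Finset.coe_range, Set.mem_Iio]
    exact Nat.lt_succ_of_le (Nat.div_le_div_right hn.1.le)
  · have key : ∀ a b : ℕ, nearestIntDist ((a + c : ℕ) * x) < δ →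
        nearestIntDist ((b + c : ℕ) * x) < δ →
        a / D = b / D → ¬ a < b := by
      intro a b ha hb hab hlt
      have hd : b - a ≤ D := by
        have h1 := Nat.div_add_mod a D
        have h2 := Nat.div_add_mod b D
        have h3 := Nat.mod_lt b hD
        rw [hab] at h1
        omega
      have h4 := h (b - a) (by omega) hd
      have h5 : ((b - a : ℕ) : ℝ) * x = (b + c : ℕ) * x - (a + c : ℕ) * x := by
        push_cast [Nat.cast_sub hlt.le]
        ring
      rw [h5] at h4
      linarith [nearestIntDist_sub_le ((b + c : ℕ) * x) ((a + c : ℕ) * x)]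
    intro a ha b hb hab
    simp only [Finset.coe_filter, Finset.mem_range, Set.mem_ofPred_eq] at ha hb
    rcases lt_trichotomy a b with hlt | heq | hlt
    · exact (key a b ha.2 hb.2 hab hlt).elim
    · exact heq
    · exact (key b a hb.2 ha.2 hab.symm hlt).elim

/-- Weyl's inequality for quadratic exponential sums, uniform in the linear coefficient. -/
lemma norm_sq_quadratic_sum_le {β δ : ℝ} {D : ℕ} (hδ : 0 < δ) (hD : 0 < D)
    (h : ∀ d : ℕ, 0 < d → d ≤ D → 2 * δ ≤ nearestIntDist (d * (2 * β))) (θ : ℝ) (m : ℕ) :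
    ‖∑ n ∈ Finset.range m, unitExp (β * (n : ℝ) ^ 2 + θ * n)‖ ^ 2 ≤
      3 * m + 2 * (m : ℝ) ^ 2 / D + m / δ := by
  have h1 := norm_sq_sum_range_le (fun n : ℕ => unitExp (β * (n : ℝ) ^ 2 + θ * n)) m
  -- Differencing leaves a linear phase in b. The coefficient θ survives only in a unimodular
  -- constant, whence the uniformity.
  have h2 : ∀ k : ℕ, ‖∑ b ∈ Finset.range (m - (k + 1)),
      unitExp (β * ((k + 1 + b : ℕ) : ℝ) ^ 2 + θ * (k + 1 + b : ℕ)) *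
        (starRingEnd ℂ) (unitExp (β * (b : ℝ) ^ 2 + θ * b))‖ =
      ‖∑ b ∈ Finset.range (m - (k + 1)), unitExp (b * ((k + 1 : ℕ) * (2 * β)))‖ := by
    intro k
    rw [← one_mul ‖∑ b ∈ Finset.range (m - (k + 1)), unitExp (b * ((k + 1 : ℕ) * (2 * β)))‖,
      ← norm_unitExp (β * (k + 1 : ℕ) ^ 2 + θ * (k + 1 : ℕ)), ← norm_mul, Finset.mul_sum]
    congr 1
    refine Finset.sum_congr rfl fun b _ => ?_
    rw [conj_unitExp, ← unitExp_add, ← unitExp_add]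
    congr 1
    push_cast
    ring
  simp only [norm_unitExp, one_pow, Finset.sum_const, Finset.card_range, nsmul_eq_mul,
    mul_one, h2] at h1
  -- Geometric bound for most shifts, trivial bound m for the at most m / D + 1 resonant ones.
  have h3 : ∀ k ∈ Finset.range m,
      ‖∑ b ∈ Finset.range (m - (k + 1)), unitExp (b * ((k + 1 : ℕ) * (2 * β)))‖ ≤
      1 / (2 * δ) + if nearestIntDist ((k + 1 : ℕ) * (2 * β)) < δ then (m : ℝ) else 0 := by
    intro k _
    split_ifs with hk
    · have := norm_sum_unitExp_le_card (Finset.range (m - (k + 1)))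
        (fun b : ℕ => b * ((k + 1 : ℕ) * (2 * β)))
      rw [Finset.card_range] at this
      have h4 : ((m - (k + 1) : ℕ) : ℝ) ≤ m := by exact_mod_cast Nat.sub_le _ _
      have : 0 ≤ 1 / (2 * δ) := by positivity
      linarith
    · push Not at hk
      rw [add_zero, le_div_iff₀ (by positivity)]
      refine le_trans ?_ (norm_geom_sum_unitExp_mul_le ((k + 1 : ℕ) * (2 * β)) (m - (k + 1)))
      gcongr
  have h4 := Finset.sum_le_sum h3
  rw [Finset.sum_add_distrib, Finset.sum_const, Finset.card_range, nsmul_eq_mul,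
    ← Finset.sum_filter, Finset.sum_const, nsmul_eq_mul] at h4
  have h5 := card_filter_nearestIntDist_lt_le hD h 1 m
  have h6 : ((((Finset.range m).filter fun k : ℕ =>
      nearestIntDist ((k + 1 : ℕ) * (2 * β)) < δ).card : ℕ) : ℝ) ≤ m / D + 1 := by
    refine (Nat.cast_le.2 h5).trans ?_
    push_cast
    gcongr
    exact Nat.cast_div_le
  have h7 : (((Finset.range m).filter fun k : ℕ =>
      nearestIntDist ((k + 1 : ℕ) * (2 * β)) < δ).card : ℝ) * m ≤ (m / D + 1) * m := by gcongr
  have h8 : 2 * (m * (1 / (2 * δ)) + ((m : ℝ) / D + 1) * m) =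
      2 * m + 2 * (m : ℝ) ^ 2 / D + m / δ := by field_simp; ring
  linarith

/-! ### The detecting kernel cos^(2K)(πx) -/

lemma cos_pow_eq_sum_unitExp (x : ℝ) (K : ℕ) :
    ((Real.cos (Real.pi * x) ^ (2 * K) : ℝ) : ℂ) = (4 ^ K : ℂ)⁻¹ *
      ∑ j ∈ Finset.range (2 * K + 1),
        ((2 * K).choose j : ℂ) * unitExp ((((j : ℤ) - K : ℤ) : ℝ) * x) := by
  have h1 : (2 * Complex.cos (Real.pi * x)) = unitExp (x / 2) + unitExp (-(x / 2)) := by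
    rw [Complex.two_cos, unitExp, unitExp]
    congr 2 <;> (push_cast; ring)
  have h2 : (4 ^ K : ℂ) * Complex.cos (Real.pi * x) ^ (2 * K) =
      (unitExp (x / 2) + unitExp (-(x / 2))) ^ (2 * K) := by
    rw [← h1, mul_pow, pow_mul 2 2 K]
    norm_num
  push_cast
  rw [eq_inv_mul_iff_mul_eq₀ (by simp), h2, add_pow]
  refine Finset.sum_congr rfl fun j hj => ?_
  rw [mul_comm, ← unitExp_nat_mul, ← unitExp_nat_mul, ← unitExp_add]
  congr 2
  have : j ≤ 2 * K := Nat.lt_succ_iff.1 (Finset.mem_range.1 hj)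
  push_cast [Nat.cast_sub this]
  ring

lemma sum_choose_two_mul (K : ℕ) :
    ∑ j ∈ Finset.range (2 * K + 1), ((2 * K).choose j : ℝ) = 4 ^ K := by
  have := Nat.sum_range_choose (2 * K)
  rw [pow_mul] at this
  exact_mod_cast this

/-- The constant Fourier coefficient of the kernel is at least 1/(2K). -/
lemma four_pow_le_two_mul_mul_choose {K : ℕ} (hK : 0 < K) :
    (4 : ℝ) ^ K ≤ 2 * K * (2 * K).choose K := by
  have := Nat.four_pow_le_two_mul_self_mul_centralBinom K hK
  rw [Nat.centralBinom] at this
  exact_mod_cast this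

/-- The fourth Taylor term of exp is (16/3)K³ · 2Ke⁸; this is the source of the exponent 8 and of
the condition 3 ≤ K. -/
lemma sixteen_mul_sq_le_exp {K : ℕ} {e : ℝ} (hK : 3 ≤ K) (hKe : 1 ≤ 2 * K * e ^ 8) :
    16 * (K : ℝ) ^ 2 ≤ Real.exp (4 * K * e ^ 2) := by
  have h1 := Real.pow_div_factorial_le_exp (4 * K * e ^ 2) (by positivity) 4
  have h2 : (4 * K * e ^ 2) ^ 4 / ((Nat.factorial 4 : ℕ) : ℝ) =
      16 / 3 * (K : ℝ) ^ 3 * (2 * K * e ^ 8) := by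
    norm_num [Nat.factorial]
    ring
  rw [h2] at h1
  have h3 : (3 : ℝ) ≤ K := by exact_mod_cast hK
  have h4 : 16 / 3 * (K : ℝ) ^ 3 * 1 ≤ 16 / 3 * (K : ℝ) ^ 3 * (2 * K * e ^ 8) := by gcongr
  have h5 : (K : ℝ) ^ 2 * 3 ≤ (K : ℝ) ^ 2 * K := by gcongr
  nlinarith

lemma cos_pow_le_of_le_nearestIntDist {K : ℕ} {e x : ℝ} (hK : 3 ≤ K) (he : 0 ≤ e)
    (hKe : 1 ≤ 2 * K * e ^ 8) (hx : e ≤ nearestIntDist x) :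
    Real.cos (Real.pi * x) ^ (2 * K) ≤ 1 / (16 * (K : ℝ) ^ 2) := by
  have hK0 : (0 : ℝ) < K := by exact_mod_cast (by omega : 0 < K)
  have h1 := cos_sq_le_of_le_nearestIntDist he hx
  have h2 : Real.cos (Real.pi * x) ^ 2 ≤ Real.exp (-(4 * e ^ 2)) := by
    linarith [Real.add_one_le_exp (-(4 * e ^ 2))]
  calc Real.cos (Real.pi * x) ^ (2 * K) = (Real.cos (Real.pi * x) ^ 2) ^ K := pow_mul _ _ _
    _ ≤ Real.exp (-(4 * e ^ 2)) ^ K := by gcongr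
    _ = (Real.exp (4 * K * e ^ 2))⁻¹ := by
        rw [← Real.exp_nat_mul, ← Real.exp_neg]
        congr 1
        ring
    _ ≤ (16 * (K : ℝ) ^ 2)⁻¹ := by
        gcongr
        exact sixteen_mul_sq_le_exp hK hKe
    _ = 1 / (16 * (K : ℝ) ^ 2) := (one_div _).symm

/-- If all exponential sums of frequency at most `K` of a finite sequence in the two-dimensional
torus are small, then the sequence meets the box of radius `e` about the origin. -/
lemma exists_nearestIntDist_lt_of_sums_small {x y : ℕ → ℝ} {m K : ℕ} {e : ℝ} (hm : 0 < m)
    (hK : 3 ≤ K) (he : 0 ≤ e) (hKe : 1 ≤ 2 * K * e ^ 8)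
    (h : ∀ j l : ℤ, |j| ≤ K → |l| ≤ K → (j ≠ 0 ∨ l ≠ 0) →
      ‖∑ n ∈ Finset.range m, unitExp (j * x n + l * y n)‖ ≤ m / (16 * (K : ℝ) ^ 2)) :
    ∃ n < m, nearestIntDist (x n) < e ∧ nearestIntDist (y n) < e := by
  by_contra! hcon
  have hK0 : (0 : ℝ) < K := by exact_mod_cast (by omega : 0 < K)
  have hm0 : (0 : ℝ) < m := by exact_mod_cast hm
  set g : ℝ → ℝ := fun t => Real.cos (Real.pi * t) ^ (2 * K) with hg
  have hg0 : ∀ t, 0 ≤ g t := fun t => by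
    simp only [hg, pow_mul]
    positivity
  have hg1 : ∀ t, g t ≤ 1 := fun t => by
    simp only [hg, pow_mul]
    exact pow_le_one₀ (sq_nonneg _) (Real.cos_sq_le_one _)
  set B : ℝ := m / (16 * (K : ℝ) ^ 2) with hB
  have hB0 : 0 ≤ B := by positivity
  -- If every n misses the box, one of the two factors is always at most 1/(16K²).
  have upper : ∑ n ∈ Finset.range m, g (x n) * g (y n) ≤ B := by
    have : ∀ n ∈ Finset.range m, g (x n) * g (y n) ≤ 1 / (16 * (K : ℝ) ^ 2) := by
      intro n hn
      by_cases hx : nearestIntDist (x n) < e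
      · have h2 : g (y n) ≤ 1 / (16 * (K : ℝ) ^ 2) := cos_pow_le_of_le_nearestIntDist hK he hKe
          (hcon n (Finset.mem_range.1 hn) hx)
        exact (mul_le_of_le_one_left (hg0 _) (hg1 _)).trans h2
      · have h2 : g (x n) ≤ 1 / (16 * (K : ℝ) ^ 2) :=
          cos_pow_le_of_le_nearestIntDist hK he hKe (not_lt.1 hx)
        exact (mul_le_of_le_one_right (hg0 _) (hg1 _)).trans h2
    refine (Finset.sum_le_sum this).trans_eq ?_
    rw [Finset.sum_const, Finset.card_range, nsmul_eq_mul, hB]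
    ring
  set R := Finset.range (2 * K + 1) ×ˢ Finset.range (2 * K + 1) with hR
  set c : ℕ × ℕ → ℝ := fun p => ((2 * K).choose p.1 : ℝ) * ((2 * K).choose p.2 : ℝ) with hc
  set S : ℕ × ℕ → ℂ := fun p => ∑ n ∈ Finset.range m,
    unitExp ((((p.1 : ℤ) - K : ℤ) : ℝ) * x n + (((p.2 : ℤ) - K : ℤ) : ℝ) * y n) with hS
  have hc0 : ∀ p, 0 ≤ c p := fun p => by positivity
  have hcsum : ∑ p ∈ R, c p = 16 ^ K := by
    rw [hR, Finset.sum_product]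
    simp only [hc]
    rw [← Finset.sum_mul_sum, sum_choose_two_mul, ← mul_pow]
    norm_num
  have expand : ((16 ^ K * ∑ n ∈ Finset.range m, g (x n) * g (y n) : ℝ) : ℂ) =
      ∑ p ∈ R, (c p : ℂ) * S p := by
    have h1 : ∀ n, ((g (x n) * g (y n) : ℝ) : ℂ) = (16 ^ K : ℂ)⁻¹ * ∑ p ∈ R, (c p : ℂ) *
        unitExp ((((p.1 : ℤ) - K : ℤ) : ℝ) * x n + (((p.2 : ℤ) - K : ℤ) : ℝ) * y n) := by
      intro n
      rw [Complex.ofReal_mul, hg, cos_pow_eq_sum_unitExp, cos_pow_eq_sum_unitExp,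
        mul_mul_mul_comm, Finset.sum_mul_sum, ← Finset.sum_product', ← mul_inv, ← mul_pow]
      congr 1
      · norm_num
      · refine Finset.sum_congr rfl fun p _ => ?_
        rw [unitExp_add, hc]
        push_cast
        ring
    rw [Complex.ofReal_mul, Complex.ofReal_sum]
    simp_rw [h1]
    rw [← Finset.mul_sum, ← mul_assoc, Complex.ofReal_pow, Complex.ofReal_ofNat,
      mul_inv_cancel₀ (by simp), one_mul, Finset.sum_comm]
    simp_rw [← Finset.mul_sum, hS]
  have hKR : (K, K) ∈ R := by
    simp only [hR, Finset.mem_product, Finset.mem_range]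
    omega
  have hSK : S (K, K) = m := by simp [hS, unitExp_zero]
  have hSp : ∀ p ∈ R.erase (K, K), ‖(c p : ℂ) * S p‖ ≤ c p * B := by
    intro p hp
    rw [norm_mul, Complex.norm_real, Real.norm_of_nonneg (hc0 p)]
    refine mul_le_mul_of_nonneg_left ?_ (hc0 p)
    simp only [hR, Finset.mem_erase, Finset.mem_product, Finset.mem_range, ne_eq,
      Prod.ext_iff] at hp
    refine h _ _ ?_ ?_ ?_
    · rw [abs_le]; omega
    · rw [abs_le]; omega
    · omega
  have herr : ‖∑ p ∈ R.erase (K, K), (c p : ℂ) * S p‖ ≤ 16 ^ K * B := by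
    refine (norm_sum_le _ _).trans ((Finset.sum_le_sum hSp).trans ?_)
    rw [← hcsum, Finset.sum_mul]
    exact Finset.sum_le_sum_of_subset_of_nonneg (Finset.erase_subset _ _)
      fun p _ _ => mul_nonneg (hc0 p) hB0
  have hre : 16 ^ K * ∑ n ∈ Finset.range m, g (x n) * g (y n) =
      (∑ p ∈ R.erase (K, K), (c p : ℂ) * S p).re + c (K, K) * m := by
    have h1 := congrArg Complex.re expand
    rw [Complex.ofReal_re, ← Finset.sum_erase_add R _ hKR, hSK, Complex.add_re] at h1
    rw [h1]
    congr 1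
    simp
  have hcK : (16 : ℝ) ^ K ≤ 4 * K ^ 2 * c (K, K) := by
    have h1 := four_pow_le_two_mul_mul_choose (K := K) (by omega)
    calc (16 : ℝ) ^ K = (4 : ℝ) ^ K * 4 ^ K := by rw [← mul_pow]; norm_num
      _ ≤ (2 * K * (2 * K).choose K) * (2 * K * (2 * K).choose K) := by gcongr
      _ = 4 * K ^ 2 * c (K, K) := by simp only [hc]; ring
  have h3 := (abs_le.1 (Complex.abs_re_le_norm (∑ p ∈ R.erase (K, K), (c p : ℂ) * S p))).1
  -- After division by 16^K the main term is at least m/(4K²) = 4B. The error is at most B, so the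
  -- sum is at least 3B, against the upper bound B.
  have h4 : 4 * 16 ^ K * B ≤ c (K, K) * m := by
    rw [hB]
    have : 16 ^ K * (m : ℝ) ≤ 4 * K ^ 2 * c (K, K) * m := by gcongr
    have h5 : 4 * 16 ^ K * ((m : ℝ) / (16 * K ^ 2)) = (16 ^ K * (m : ℝ)) / (4 * K ^ 2) := by
      field_simp
      norm_num
    rw [h5, div_le_iff₀ (by positivity)]
    linarith
  have h6 : (16 : ℝ) ^ K * ∑ n ∈ Finset.range m, g (x n) * g (y n) ≤ 16 ^ K * B := by gcongr
  have h7 : 0 < (16 : ℝ) ^ K * B := by positivity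
  linarith

/-! ### Linear resonance as the only obstruction -/

/-- `N` is a sum of two elements of the quadratic Bohr set, unless a small multiple of `αN` is
close to an integer. -/
lemma mem_kSumset_two_of_diophantine {ε : ℕ → ℝ} {α e : ℝ} {K N : ℕ} (hN : 0 < N) (hK : 3 ≤ K)
    (he : 0 ≤ e) (hKe : 1 ≤ 2 * K * e ^ 8) (heε : ∀ n ≤ N, e ≤ ε n)
    (hα : ∀ q : ℕ, 0 < q → q ≤ 6144 * K ^ 5 → 3072 * (K : ℝ) ^ 4 / N ≤ nearestIntDist (q * α))
    (hαN : ∀ l : ℕ, 0 < l → l ≤ K →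
      8 * (K : ℝ) ^ 2 / N ≤ nearestIntDist (N * (2 * l * α))) :
    N ∈ kSumset 2 (quadSet ε α) := by
  have hK0 : (0 : ℝ) < K := by exact_mod_cast (by omega : 0 < K)
  have hN0 : (0 : ℝ) < N := by exact_mod_cast hN
  have hm0 : (0 : ℝ) < (N + 1 : ℕ) := by positivity
  suffices hsuff : ∃ n < N + 1, nearestIntDist (α * (n : ℝ) ^ 2) < e ∧
      nearestIntDist (α * ((N : ℝ) - n) ^ 2) < e by
    obtain ⟨n, hn, h1, h2⟩ := hsuff
    have hn' : n ≤ N := Nat.lt_succ_iff.1 hn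
    refine ⟨![n, N - n], ?_, ?_⟩
    · intro i
      fin_cases i
      · exact h1.trans_le (heε n hn')
      · simp only [quadSet, Set.mem_ofPred_eq]
        simp only [Fin.mk_one, Matrix.cons_val_one, Matrix.cons_val_zero, Nat.cast_sub hn']
        exact h2.trans_le (heε _ (Nat.sub_le _ _))
    · simp only [Fin.sum_univ_two, Matrix.cons_val_one, Matrix.cons_val_zero]
      omega
  refine exists_nearestIntDist_lt_of_sums_small (x := fun n : ℕ => α * (n : ℝ) ^ 2)
    (y := fun n : ℕ => α * ((N : ℝ) - n) ^ 2) (Nat.succ_pos N) hK he hKe ?_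
  intro j l hj hl hjl
  have hrw : ∀ n : ℕ, unitExp (j * (α * (n : ℝ) ^ 2) + l * (α * ((N : ℝ) - n) ^ 2)) =
      unitExp (l * α * N ^ 2) *
        unitExp (((j + l : ℤ) : ℝ) * α * (n : ℝ) ^ 2 + (-(2 * l * α * N)) * n) := by
    intro n
    rw [← unitExp_add]
    congr 1
    push_cast
    ring
  simp_rw [hrw]
  rw [← Finset.mul_sum, norm_mul, norm_unitExp, one_mul]
  by_cases hs : j + l = 0
  · have hl0 : l ≠ 0 := by omega
    have h1 : ∀ n : ℕ, ((j + l : ℤ) : ℝ) * α * (n : ℝ) ^ 2 + (-(2 * l * α * N)) * n =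
        n * (-(2 * l * α * N)) := by
      intro n
      rw [hs]
      push_cast
      ring
    simp_rw [h1]
    have h2 := norm_geom_sum_unitExp_mul_le (-(2 * l * α * N)) (N + 1)
    have h3 : 8 * (K : ℝ) ^ 2 / N ≤ nearestIntDist (-(2 * l * α * N)) := by
      have h4 : -(2 * l * α * N) = -(l * (2 * α * N)) := by ring
      rw [h4, nearestIntDist_neg, nearestIntDist_int_mul]
      have h5 : (l.natAbs : ℝ) * (2 * α * N) = N * (2 * l.natAbs * α) := by ring
      rw [h5]
      refine hαN l.natAbs (by omega) ?_
      rw [Int.abs_eq_natAbs] at hl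
      exact_mod_cast hl
    rw [le_div_iff₀ (by positivity)]
    have h5 : ‖∑ n ∈ Finset.range (N + 1), unitExp (n * (-(2 * l * α * N)))‖ *
        (2 * (8 * (K : ℝ) ^ 2 / N)) ≤ 1 := le_trans (by gcongr) h2
    have h6 : ‖∑ n ∈ Finset.range (N + 1), unitExp (n * (-(2 * l * α * N)))‖ *
        (2 * (8 * (K : ℝ) ^ 2 / N)) =
        ‖∑ n ∈ Finset.range (N + 1), unitExp (n * (-(2 * l * α * N)))‖ *
        (16 * (K : ℝ) ^ 2) / N := by ring
    rw [h6, div_le_iff₀ hN0] at h5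
    push_cast
    linarith
  · have hD : 0 < 1536 * K ^ 4 := by positivity
    -- The target (m/(16K²))² equals 6m²/(1536K⁴). With these δ and D, the last two terms of Weyl's
    -- bound use at most half of it.
    have hw := norm_sq_quadratic_sum_le (β := ((j + l : ℤ) : ℝ) * α)
      (δ := 1536 * (K : ℝ) ^ 4 / N) (D := 1536 * K ^ 4) (by positivity) hD ?_
      (-(2 * l * α * N)) (N + 1)
    · rw [← pow_le_pow_iff_left₀ (norm_nonneg _) (by positivity) two_ne_zero]
      refine hw.trans ?_
      -- Since ‖α‖ ≤ 1/2, the case q = 1 gives 1536K⁴ ≤ N/4, which controls the term 3m.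
      have h1 := (hα 1 one_pos (Nat.one_le_iff_ne_zero.2 (by positivity))).trans
        (nearestIntDist_le_half _)
      rw [div_le_iff₀ hN0] at h1
      have hmN : ((N + 1 : ℕ) : ℝ) = N + 1 := by push_cast; ring
      set m : ℝ := ((N + 1 : ℕ) : ℝ)
      have h2 : 3 * m + 2 * m ^ 2 / ((1536 * K ^ 4 : ℕ) : ℝ) + m / (1536 * (K : ℝ) ^ 4 / N) =
          (3 * m * (1536 * (K : ℝ) ^ 4) + 2 * m ^ 2 + m * N) / (1536 * (K : ℝ) ^ 4) := by
        push_cast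
        field_simp
      have h3 : (m / (16 * (K : ℝ) ^ 2)) ^ 2 = (6 * m ^ 2) / (1536 * (K : ℝ) ^ 4) := by
        field_simp
        norm_num
      rw [h2, h3]
      gcongr
      have h4 : m * (1536 * (K : ℝ) ^ 4) ≤ m * (m / 4) := by
        gcongr
        linarith
      have h5 : m * N ≤ m * m := by
        gcongr
        linarith
      nlinarith
    · intro d hd hdD
      have h1 : (d : ℝ) * (2 * (((j + l : ℤ) : ℝ) * α)) = ((2 * d * (j + l) : ℤ) : ℝ) * α := by
        push_cast
        ring
      have h2 : (2 * d * (j + l) : ℤ).natAbs = 2 * d * (j + l).natAbs := by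
        rw [Int.natAbs_mul, Int.natAbs_mul]
        simp
      have h3 : (j + l).natAbs ≤ 2 * K := by
        rw [Int.abs_eq_natAbs] at hj hl
        omega
      have h4 : 2 * d * (j + l).natAbs ≤ 6144 * K ^ 5 := by
        calc 2 * d * (j + l).natAbs ≤ 2 * (1536 * K ^ 4) * (2 * K) := by gcongr
          _ = 6144 * K ^ 5 := by ring
      have h5 : 0 < 2 * d * (j + l).natAbs := by
        have := Int.natAbs_pos.2 hs
        positivity
      rw [h1, nearestIntDist_int_mul, h2]
      refine le_trans (le_of_eq ?_) (hα _ h5 h4)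
      ring

/-! ### Good levels and the sparsity of exceptions -/

/-- Up to `N`, the number `α` has no good rational approximations with denominators bounded in
terms of `K`, and `ε` is not too small in terms of `K`. -/
structure GoodLevel (ε : ℕ → ℝ) (α : ℝ) (K N : ℕ) : Prop where
  pos : 0 < N
  three_le : 3 ≤ K
  diophantine : ∀ q : ℕ, 0 < q → q ≤ 6144 * K ^ 5 →
    3072 * (K : ℝ) ^ 5 / N ≤ nearestIntDist (q * α)
  radius : ∃ e : ℝ, 0 ≤ e ∧ 1 ≤ 2 * K * e ^ 8 ∧ ∀ n ≤ N, e ≤ ε n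

namespace GoodLevel

variable {ε : ℕ → ℝ} {α : ℝ} {K N : ℕ}

lemma pow_five_le (h : GoodLevel ε α K N) : K ^ 5 ≤ N := by
  have hN : (0 : ℝ) < N := by exact_mod_cast h.pos
  have hK := h.three_le
  have h1 := (h.diophantine 1 one_pos (Nat.one_le_iff_ne_zero.2 (by positivity))).trans
    (nearestIntDist_le_half _)
  rw [div_le_iff₀ hN] at h1
  have : (K : ℝ) ^ 5 ≤ N := by
    have : (0 : ℝ) ≤ (K : ℝ) ^ 5 := by positivity
    linarith
  exact_mod_cast this

/-- The factor K⁵ in `diophantine`, one power more than needed at N itself, lets a single level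
serve all n between N/K and N. -/
lemma exists_nearestIntDist_lt (h : GoodLevel ε α K N) {n : ℕ} (hn : n ≤ N) (hNn : N ≤ K * n)
    (hn2 : n ∉ kSumset 2 (quadSet ε α)) :
    ∃ l : ℕ, 0 < l ∧ l ≤ K ∧ nearestIntDist (n * (2 * l * α)) < 8 * (K : ℝ) ^ 2 / n := by
  by_contra! hcon
  obtain ⟨e, he, hKe, heε⟩ := h.radius
  have hn0 : 0 < n := by
    rcases Nat.eq_zero_or_pos n with rfl | h0
    · have := h.pos
      omega
    · exact h0
  have hN : (0 : ℝ) < N := by exact_mod_cast h.pos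
  have hnR : (0 : ℝ) < n := by exact_mod_cast hn0
  refine hn2 (mem_kSumset_two_of_diophantine hn0 h.three_le he hKe
    (fun k hk => heε k (hk.trans hn)) (fun q hq hqK => ?_) hcon)
  refine le_trans ?_ (h.diophantine q hq hqK)
  rw [div_le_div_iff₀ hnR hN]
  have : (N : ℝ) ≤ K * n := by exact_mod_cast hNn
  calc 3072 * (K : ℝ) ^ 4 * N ≤ 3072 * (K : ℝ) ^ 4 * (K * n) := by gcongr
    _ = 3072 * (K : ℝ) ^ 5 * n := by ring

/-- The n ≤ N/K are counted trivially. Beyond them, the resonances of each l ≤ K are more than K²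
apart, so each l contributes about N/K². -/
lemma exceptionCount_le (h : GoodLevel ε α K N) :
    (exceptionCount (quadSet ε α) N : ℝ) ≤ 4 * N / K := by
  classical
  have hK := h.three_le
  have hN : (0 : ℝ) < N := by exact_mod_cast h.pos
  have hK0 : (0 : ℝ) < K := by exact_mod_cast (by omega : 0 < K)
  set F : ℕ → Finset ℕ := fun l => (Finset.range (N + 1)).filter fun n : ℕ =>
    nearestIntDist ((n + 0 : ℕ) * (2 * l * α)) < 8 * (K : ℝ) ^ 3 / N with hF
  have hFcard : ∀ l ∈ Finset.Icc 1 K, (F l).card ≤ (N + 1) / K ^ 2 + 1 := by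
    intro l hl
    rw [Finset.mem_Icc] at hl
    refine card_filter_nearestIntDist_lt_le (by positivity) (fun d hd hdD => ?_) 0 (N + 1)
    have h1 : (d : ℝ) * (2 * l * α) = (2 * l * d : ℕ) * α := by
      push_cast
      ring
    have h2 : 2 * l * d ≤ 6144 * K ^ 5 := by
      calc 2 * l * d ≤ 2 * K * K ^ 2 := by
            gcongr
            exact hl.2
        _ = 2 * K ^ 3 := by ring
        _ ≤ 6144 * K ^ 5 := by gcongr <;> omega
    rw [h1]
    refine le_trans ?_ (h.diophantine _ (by have := hl.1; positivity) h2)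
    rw [← mul_div_assoc, ← mul_assoc]
    have h3 : (1 : ℝ) ≤ K := by exact_mod_cast (by omega : 1 ≤ K)
    have h4 : (K : ℝ) ^ 3 ≤ (K : ℝ) ^ 5 := pow_le_pow_right₀ h3 (by norm_num)
    gcongr
    linarith
  have hsub : Set.Icc 1 N \ kSumset 2 (quadSet ε α) ⊆
      ((Finset.Icc 1 (N / K) ∪ (Finset.Icc 1 K).biUnion F : Finset ℕ) : Set ℕ) := by
    rintro n ⟨⟨hn1, hnN⟩, hn2⟩
    simp only [Finset.coe_union, Set.mem_union, Finset.mem_coe, Finset.mem_Icc,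
      Finset.mem_biUnion]
    by_cases hnK : n ≤ N / K
    · exact Or.inl ⟨hn1, hnK⟩
    · have h1 : N < n * K := (Nat.div_lt_iff_lt_mul (by omega)).1 (not_le.1 hnK)
      obtain ⟨l, hl0, hlK, hl⟩ := h.exists_nearestIntDist_lt hnN (by linarith) hn2
      refine Or.inr ⟨l, ⟨hl0, hlK⟩, ?_⟩
      simp only [hF, Finset.mem_filter, Finset.mem_range, add_zero]
      refine ⟨by omega, hl.trans_le ?_⟩
      have hnR : (0 : ℝ) < n := by exact_mod_cast hn1
      rw [div_le_div_iff₀ hnR hN]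
      have : (N : ℝ) ≤ n * K := by exact_mod_cast h1.le
      calc 8 * (K : ℝ) ^ 2 * N ≤ 8 * (K : ℝ) ^ 2 * (n * K) := by gcongr
        _ = 8 * (K : ℝ) ^ 3 * n := by ring
  have hcard : exceptionCount (quadSet ε α) N ≤ N / K + K * ((N + 1) / K ^ 2 + 1) := by
    refine (Set.ncard_le_ncard hsub (Finset.finite_toSet _)).trans ?_
    rw [Set.ncard_coe_finset]
    refine (Finset.card_union_le _ _).trans ?_
    gcongr
    · simp
    · refine (Finset.card_biUnion_le).trans ((Finset.sum_le_sum hFcard).trans ?_)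
      simp
  have hcardR : (exceptionCount (quadSet ε α) N : ℝ) ≤ N / K + K * ((N + 1) / K ^ 2 + 1) := by
    refine (Nat.cast_le.2 hcard).trans ?_
    push_cast
    gcongr
    · exact Nat.cast_div_le
    · refine Nat.cast_div_le.trans ?_
      push_cast
      rfl
  refine hcardR.trans ?_
  have h1 : (N : ℝ) / K + K * ((N + 1) / K ^ 2 + 1) = (2 * N + 1 + K ^ 2) / K := by
    field_simp
    ring
  rw [h1]
  gcongr
  have h2 : K ^ 2 + 1 ≤ 2 * N := by
    have h3 := h.pow_five_le
    have h4 : K ^ 2 ≤ K ^ 5 := Nat.pow_le_pow_right (by omega) (by norm_num)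
    have := h.pos
    omega
  have h3 : (K : ℝ) ^ 2 + 1 ≤ 2 * N := by exact_mod_cast h2
  linarith

/-- Of two integers near `N` at a fixed distance, at least one lies in `2A`. -/
lemma mem_kSumset_two_or (h : GoodLevel ε α K N) {a b : ℕ} (hab : a < b) (hbK : b ≤ K)
    (hbN : 2 * b ≤ N) :
    N - a ∈ kSumset 2 (quadSet ε α) ∨ N - b ∈ kSumset 2 (quadSet ε α) := by
  by_contra! hcon
  have hK := h.three_le
  have hN : (0 : ℝ) < N := by exact_mod_cast h.pos
  have hK0 : (0 : ℝ) < K := by exact_mod_cast (by omega : 0 < K)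
  have key : ∀ c : ℕ, c ≤ b → N - c ∉ kSumset 2 (quadSet ε α) → ∃ l : ℕ, 0 < l ∧ l ≤ K ∧
      nearestIntDist (((N : ℝ) - c) * (2 * l * α)) < 16 * (K : ℝ) ^ 2 / N := by
    intro c hc hcN
    have h1 : N ≤ K * (N - c) := by
      calc N ≤ 3 * (N - c) := by omega
        _ ≤ K * (N - c) := by gcongr
    obtain ⟨l, hl0, hlK, hl⟩ := h.exists_nearestIntDist_lt (Nat.sub_le N c) h1 hcN
    refine ⟨l, hl0, hlK, ?_⟩
    rw [Nat.cast_sub (by omega)] at hl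
    refine hl.trans_le ?_
    have h2 : (2 * c : ℝ) ≤ N := by exact_mod_cast (by omega : 2 * c ≤ N)
    rw [div_le_div_iff₀ (by linarith) hN]
    have : 0 ≤ 8 * (K : ℝ) ^ 2 := by positivity
    nlinarith
  obtain ⟨l, hl0, hlK, hl⟩ := key a hab.le hcon.1
  obtain ⟨k, hk0, hkK, hk⟩ := key b le_rfl hcon.2
  have h1 := h.diophantine (2 * l * k * (b - a))
    (by have : 0 < b - a := by omega
        positivity) (by
      calc 2 * l * k * (b - a) ≤ 2 * K * K * K := by
            gcongr
            omega
        _ = 2 * K ^ 3 := by ring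
        _ ≤ 6144 * K ^ 5 := by gcongr <;> omega)
  -- Multiplying the two resonances by k and l cancels N.
  have h2 : ((2 * l * k * (b - a) : ℕ) : ℝ) * α =
      k * (((N : ℝ) - a) * (2 * l * α)) - l * (((N : ℝ) - b) * (2 * k * α)) := by
    push_cast [Nat.cast_sub hab.le]
    ring
  rw [h2] at h1
  have h3 := nearestIntDist_sub_le (k * (((N : ℝ) - a) * (2 * l * α)))
    (l * (((N : ℝ) - b) * (2 * k * α)))
  have h4 := nearestIntDist_nat_mul_le k (((N : ℝ) - a) * (2 * l * α))
  have h5 := nearestIntDist_nat_mul_le l (((N : ℝ) - b) * (2 * k * α))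
  have h6 : (k : ℝ) * nearestIntDist (((N : ℝ) - a) * (2 * l * α)) ≤
      K * (16 * (K : ℝ) ^ 2 / N) := by
    gcongr
    exact nearestIntDist_nonneg _
  have h7 : (l : ℝ) * nearestIntDist (((N : ℝ) - b) * (2 * k * α)) ≤
      K * (16 * (K : ℝ) ^ 2 / N) := by
    gcongr
    exact nearestIntDist_nonneg _
  have h8 : 3072 * (K : ℝ) ^ 5 / N ≤ 32 * (K : ℝ) ^ 3 / N := by
    have : 32 * (K : ℝ) ^ 3 / N = K * (16 * (K : ℝ) ^ 2 / N) + K * (16 * (K : ℝ) ^ 2 / N) := by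
      ring
    linarith
  rw [div_le_div_iff_of_pos_right hN] at h8
  have h9 : (K : ℝ) ^ 3 ≤ (K : ℝ) ^ 5 :=
    pow_le_pow_right₀ (by exact_mod_cast (by omega : 1 ≤ K)) (by norm_num)
  have h10 : (0 : ℝ) < (K : ℝ) ^ 3 := by positivity
  linarith

end GoodLevel

/-! ### From good levels to density one and order three -/

lemma isAlmostBasisOfOrder_two_of_tendsto {A : Set ℕ}
    (h : Tendsto (fun n : ℕ => (exceptionCount A n : ℝ) / n) atTop (𝓝 0)) :
    IsAlmostBasisOfOrder 2 A := by
  have h1 : Tendsto (fun n : ℕ => 1 - (exceptionCount A n : ℝ) / n) atTop (𝓝 1) := by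
    simpa using h.const_sub 1
  refine h1.congr' ?_
  filter_upwards [eventually_gt_atTop 0] with n hn
  have h2 := Set.ncard_inter_add_ncard_sdiff_eq_ncard (Set.Icc 1 n) (kSumset 2 A)
    (Set.finite_Icc 1 n)
  have h3 : (Set.Icc 1 n).ncard = n := by
    rw [← Finset.coe_Icc, Set.ncard_coe_finset]
    simp
  rw [h3, Set.inter_comm] at h2
  have h4 : ((kSumset 2 A ∩ Set.Icc 1 n).ncard : ℝ) + exceptionCount A n = n := by
    exact_mod_cast h2
  have hn0 : (n : ℝ) ≠ 0 := by exact_mod_cast hn.ne'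
  rw [eq_div_iff hn0, sub_mul, div_mul_cancel₀ _ hn0]
  linarith

lemma add_mem_kSumset_three {A : Set ℕ} {m a : ℕ} (hm : m ∈ kSumset 2 A) (ha : a ∈ A) :
    m + a ∈ kSumset 3 A := by
  obtain ⟨f, hf, rfl⟩ := hm
  refine ⟨Fin.cons a f, fun i => ?_, ?_⟩
  · refine Fin.cases ?_ (fun j => ?_) i
    · simpa using ha
    · simpa using hf j
  · rw [Fin.sum_univ_succ, Fin.cons_zero, add_comm]
    simp

/-- If A had at most one element, so would 2A. This supplies the two shifts a < b for order three.
-/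
lemma nontrivial_of_exceptionCount_lt {A : Set ℕ} {N : ℕ} (h : exceptionCount A N + 1 < N) :
    ∃ a ∈ A, ∃ b ∈ A, a < b := by
  by_contra! hcon
  have hsub : A.Subsingleton := fun a ha b hb => le_antisymm (hcon b hb a ha) (hcon a ha b hb)
  have h2 : (kSumset 2 A).Subsingleton := by
    rintro _ ⟨f, hf, rfl⟩ _ ⟨g, hg, rfl⟩
    exact Finset.sum_congr rfl fun i _ => hsub (hf i) (hg i)
  have h3 := Set.ncard_inter_add_ncard_sdiff_eq_ncard (Set.Icc 1 N) (kSumset 2 A)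
    (Set.finite_Icc 1 N)
  have h4 : (Set.Icc 1 N).ncard = N := by
    rw [← Finset.coe_Icc, Set.ncard_coe_finset]
    simp
  have h5 : (Set.Icc 1 N ∩ kSumset 2 A).ncard ≤ 1 :=
    Set.ncard_le_one_iff_subsingleton.2 (h2.anti Set.inter_subset_right)
  rw [exceptionCount] at h
  omega

/-- Arbitrarily high good levels give an almost basis of order `2` and a basis of order `3`. -/
theorem isAlmostBasis_and_isBasis_of_goodLevel {ε : ℕ → ℝ} {α : ℝ}
    (h : ∀ K₀ : ℕ, ∀ᶠ N in atTop, ∃ K, K₀ ≤ K ∧ GoodLevel ε α K N) :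
    IsAlmostBasisOfOrder 2 (quadSet ε α) ∧ IsBasisOfOrder 3 (quadSet ε α) := by
  have hlim : Tendsto (fun n : ℕ => (exceptionCount (quadSet ε α) n : ℝ) / n) atTop (𝓝 0) := by
    rw [Metric.tendsto_atTop']
    intro η hη
    obtain ⟨K₀, hK₀⟩ := exists_nat_gt (4 / η)
    obtain ⟨N₀, hN₀⟩ := eventually_atTop.1 (h K₀)
    refine ⟨N₀, fun N hN => ?_⟩
    obtain ⟨K, hK, hgood⟩ := hN₀ N hN.le
    have hN0 : (0 : ℝ) < N := by exact_mod_cast hgood.pos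
    have hK0 : (0 : ℝ) < K := by
      have := hgood.three_le
      exact_mod_cast (by omega : 0 < K)
    rw [Real.dist_0_eq_abs, abs_of_nonneg (by positivity), div_lt_iff₀ hN0]
    refine hgood.exceptionCount_le.trans_lt ?_
    have h1 : 4 / η < K := hK₀.trans_le (by exact_mod_cast hK)
    rw [div_lt_iff₀ hη] at h1
    rw [div_lt_iff₀ hK0]
    nlinarith
  refine ⟨isAlmostBasisOfOrder_two_of_tendsto hlim, ?_⟩
  obtain ⟨a, ha, b, hb, hab⟩ : ∃ a ∈ quadSet ε α, ∃ b ∈ quadSet ε α, a < b := by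
    obtain ⟨N, ⟨K, hK, hgood⟩, hN⟩ := ((h 8).and (eventually_gt_atTop 4)).exists
    refine nontrivial_of_exceptionCount_lt (N := N) ?_
    have h1 := hgood.exceptionCount_le
    have hKR : (8 : ℝ) ≤ K := by exact_mod_cast hK
    have hN0 : (4 : ℝ) < N := by exact_mod_cast hN
    rw [le_div_iff₀ (by linarith)] at h1
    have h2 : (exceptionCount (quadSet ε α) N : ℝ) + 1 < N := by
      have : (exceptionCount (quadSet ε α) N : ℝ) * 8 ≤ exceptionCount (quadSet ε α) N * K := by
        gcongr
      linarith
    exact_mod_cast h2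
  rw [IsBasisOfOrder]
  filter_upwards [h b, eventually_ge_atTop (2 * b)] with N hN hNb
  obtain ⟨K, hbK, hgood⟩ := hN
  rcases hgood.mem_kSumset_two_or hab hbK hNb with h1 | h1
  · have := add_mem_kSumset_three h1 ha
    rwa [Nat.sub_add_cancel (by omega)] at this
  · have := add_mem_kSumset_three h1 hb
    rwa [Nat.sub_add_cancel (by omega)] at this

/-! ### Arbitrary irrational α -/

lemma eventually_diophantine {α : ℝ} (hα : Irrational α) (K : ℕ) :
    ∀ᶠ N : ℕ in atTop, ∀ q : ℕ, 0 < q → q ≤ 6144 * K ^ 5 →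
      3072 * (K : ℝ) ^ 5 / N ≤ nearestIntDist (q * α) := by
  have h : ∀ᶠ N : ℕ in atTop, ∀ q ∈ Finset.Icc (1 : ℕ) (6144 * K ^ 5),
      3072 * (K : ℝ) ^ 5 / N ≤ nearestIntDist (q * α) := by
    rw [Filter.eventually_all_finset]
    intro q hq
    have h1 : 0 < nearestIntDist (q * α) :=
      nearestIntDist_pos (hα.natCast_mul (by have := (Finset.mem_Icc.1 hq).1; omega))
    exact ((tendsto_const_div_atTop_nhds_zero_nat _).eventually_lt_const h1).mono
      fun _ h => h.le
  filter_upwards [h] with N hN q hq hqK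
  exact hN q (Finset.mem_Icc.2 ⟨hq, hqK⟩)

/-- A slowly decaying sequence adapted to the rational approximations of `α`. -/
lemma exists_strictAnti_goodLevel {α : ℝ} (hα : Irrational α) :
    ∃ εα : ℕ → ℝ, StrictAnti εα ∧ Tendsto εα atTop (𝓝 0) ∧
      ∀ ε : ℕ → ℝ, (∀ n, εα n ≤ ε n) →
        ∀ K₀ : ℕ, ∀ᶠ N in atTop, ∃ K, K₀ ≤ K ∧ GoodLevel ε α K N := by
  classical
  set P : ℕ → ℕ → Prop := fun N K => 0 < N ∧ ∀ q : ℕ, 0 < q → q ≤ 6144 * K ^ 5 →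
    3072 * (K : ℝ) ^ 5 / N ≤ nearestIntDist (q * α) with hP
  have hPmono : ∀ {N N' K}, N ≤ N' → P N K → P N' K := by
    intro N N' K hN h
    refine ⟨h.1.trans_le hN, fun q hq hqK => le_trans ?_ (h.2 q hq hqK)⟩
    have : (0 : ℝ) < N := by exact_mod_cast h.1
    gcongr
  -- The largest K ≤ N that α tolerates at N. The default value 0 is harmless, as only κ N ≥ 3 is
  -- used.
  set κ : ℕ → ℕ := fun N => Nat.findGreatest (P N) N with hκ
  have hκmono : Monotone κ := fun N N' h => Nat.findGreatest_mono (fun K => hPmono h) h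
  have hκtop : Tendsto κ atTop atTop := by
    rw [tendsto_atTop]
    intro K
    filter_upwards [eventually_diophantine hα K, eventually_ge_atTop K,
      eventually_gt_atTop 0] with N hN hK h0
    exact Nat.le_findGreatest hK ⟨h0, hN⟩
  -- The power -1/8 meets the requirement 2Ke⁸ ≥ 1; the term 1/(n+1) gives strictness where κ is
  -- constant.
  refine ⟨fun n => ((κ n : ℝ) + 1) ^ (-(1 / 8) : ℝ) + 1 / ((n : ℝ) + 1), ?_, ?_, ?_⟩
  · intro a b hab
    refine add_lt_add_of_le_of_lt ?_ ?_
    · refine Real.rpow_le_rpow_of_nonpos (by positivity) ?_ (by norm_num)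
      have : (κ a : ℝ) ≤ κ b := by exact_mod_cast hκmono hab.le
      linarith
    · have : (a : ℝ) < b := by exact_mod_cast hab
      gcongr
  · have h1 : Tendsto (fun n => (κ n : ℝ) + 1) atTop atTop :=
      tendsto_atTop_add_const_right _ _ (tendsto_natCast_atTop_atTop.comp hκtop)
    have h2 := (tendsto_rpow_neg_atTop (by norm_num : (0 : ℝ) < 1 / 8)).comp h1
    simpa using h2.add tendsto_one_div_add_atTop_nhds_zero_nat
  · intro ε hε K₀
    filter_upwards [hκtop.eventually_ge_atTop (max K₀ 3)] with N hN
    have hK3 : 3 ≤ κ N := (le_max_right _ _).trans hN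
    have hPN : P N (κ N) := Nat.findGreatest_of_ne_zero rfl (by omega)
    refine ⟨κ N, (le_max_left _ _).trans hN, hPN.1, hK3, hPN.2,
      ((κ N : ℝ) + 1) ^ (-(1 / 8) : ℝ), by positivity, ?_, fun n hn => ?_⟩
    · have h1 : (((κ N : ℝ) + 1) ^ (-(1 / 8) : ℝ)) ^ 8 = ((κ N : ℝ) + 1)⁻¹ := by
        rw [← Real.rpow_natCast, ← Real.rpow_mul (by positivity)]
        norm_num
        exact Real.rpow_neg_one _
      rw [h1, ← div_eq_mul_inv, le_div_iff₀ (by positivity)]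
      have : (3 : ℝ) ≤ κ N := by exact_mod_cast hK3
      linarith
    · refine le_trans ?_ (hε n)
      have h1 : ((κ N : ℝ) + 1) ^ (-(1 / 8) : ℝ) ≤ ((κ n : ℝ) + 1) ^ (-(1 / 8) : ℝ) := by
        refine Real.rpow_le_rpow_of_nonpos (by positivity) ?_ (by norm_num)
        have : (κ n : ℝ) ≤ κ N := by exact_mod_cast hκmono hn
        linarith
      have h2 : (0 : ℝ) ≤ 1 / ((n : ℝ) + 1) := by positivity
      linarith

/-! ### Finite irrationality measure -/

lemma nearestIntDist_nat_mul_eq (α : ℝ) {q : ℕ} (hq : 0 < q) :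
    nearestIntDist (q * α) = q * |α - (round (q * α) : ℤ) / (q : ℝ)| := by
  have hq0 : (0 : ℝ) < q := by exact_mod_cast hq
  rw [nearestIntDist, ← abs_of_pos hq0, ← abs_mul, abs_of_pos hq0]
  congr 1
  field_simp

lemma exists_pow_le_nearestIntDist {α : ℝ} (hα : Irrational α)
    (h : irrationalityMeasure α < ⊤) :
    ∃ c : ℝ, 0 < c ∧ ∃ M : ℕ, ∀ q : ℕ, 0 < q → c / (q : ℝ) ^ M ≤ nearestIntDist (q * α) := by
  obtain ⟨_, ⟨μ, hμ, rfl⟩, -⟩ := sInf_lt_iff.1 h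
  obtain ⟨c, hc, hcq⟩ := hμ 1 one_pos
  obtain ⟨M, hM⟩ := exists_nat_ge (μ + 1)
  refine ⟨c, hc, M, fun q hq => ?_⟩
  have hq1 : (1 : ℝ) ≤ q := by exact_mod_cast hq
  have hne : α ≠ ((round (q * α) : ℤ) : ℝ) / (q : ℝ) := fun heq =>
    hα ⟨(round (q * α) : ℚ) / q, by push_cast; exact heq.symm⟩
  rw [nearestIntDist_nat_mul_eq α hq]
  have h1 := hcq (round (q * α)) q hq hne
  have h2 : c / (q : ℝ) ^ M ≤ c / (q : ℝ) ^ (μ + 1) := by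
    rw [← Real.rpow_natCast]
    gcongr
  have h3 := abs_nonneg (α - (round (q * α) : ℤ) / (q : ℝ))
  nlinarith

/-- Large n obey the logarithmic hypothesis. The finitely many small n only need ε n > 0, since
N^(-s) tends to 0. -/
lemma eventually_rpow_neg_le {ε : ℕ → ℝ} (hε : ∀ n, 0 < ε n)
    (h : Tendsto (fun n : ℕ => Real.log (1 / ε n) / Real.log (n : ℝ)) atTop (𝓝 0))
    {s : ℝ} (hs : 0 < s) : ∀ᶠ N : ℕ in atTop, ∀ n ≤ N, (N : ℝ) ^ (-s) ≤ ε n := by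
  obtain ⟨n₀, hn₀⟩ := eventually_atTop.1 ((h.eventually_lt_const hs).and (eventually_ge_atTop 2))
  have h1 : ∀ᶠ N : ℕ in atTop, ∀ n ∈ Finset.range n₀, (N : ℝ) ^ (-s) ≤ ε n := by
    rw [Filter.eventually_all_finset]
    intro n _
    exact (((tendsto_rpow_neg_atTop hs).comp tendsto_natCast_atTop_atTop).eventually_lt_const
      (hε n)).mono fun _ h => h.le
  filter_upwards [h1] with N hN n hn
  rcases lt_or_ge n n₀ with h2 | h2
  · exact hN n (Finset.mem_range.2 h2)
  · obtain ⟨h3, h4⟩ := hn₀ n h2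
    have hn1 : (1 : ℝ) < n := by exact_mod_cast (by omega : 1 < n)
    have hn0 : (0 : ℝ) < n := by linarith
    rw [div_lt_iff₀ (Real.log_pos hn1), one_div, Real.log_inv] at h3
    have h5 : (n : ℝ) ^ (-s) ≤ ε n := by
      rw [← Real.log_le_log_iff (by positivity) (hε n), Real.log_rpow hn0]
      linarith
    refine le_trans ?_ h5
    exact Real.rpow_le_rpow_of_nonpos hn0 (by exact_mod_cast hn) (by linarith)

/-- For q ≤ 6144K⁵ the condition is a constant times K^(5M+5) ≤ cN. The sixth K absorbs the
constant, hence 5M + 6. -/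
lemma eventually_goodLevel_floor_rpow {ε : ℕ → ℝ} {α c : ℝ} {M : ℕ} (hc : 0 < c)
    (hα : ∀ q : ℕ, 0 < q → c / (q : ℝ) ^ M ≤ nearestIntDist (q * α)) (hε : ∀ n, 0 < ε n)
    (h : Tendsto (fun n : ℕ => Real.log (1 / ε n) / Real.log (n : ℝ)) atTop (𝓝 0)) :
    ∀ᶠ N : ℕ in atTop, GoodLevel ε α ⌊(N : ℝ) ^ (1 / (5 * M + 6 : ℕ) : ℝ)⌋₊ N := by
  set η : ℝ := 1 / (5 * M + 6 : ℕ) with hη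
  have hη0 : 0 < η := by positivity
  have hK : Tendsto (fun N : ℕ => (⌊(N : ℝ) ^ η⌋₊ : ℝ)) atTop atTop :=
    tendsto_natCast_atTop_atTop.comp
      (tendsto_nat_floor_atTop.comp ((tendsto_rpow_atTop hη0).comp tendsto_natCast_atTop_atTop))
  filter_upwards [eventually_gt_atTop 0, hK.eventually_ge_atTop 3,
    hK.eventually_ge_atTop (3072 * 6144 ^ M / c),
    eventually_rpow_neg_le hε h (s := η / 16) (by positivity)] with N hN hK3 hKc hNε
  have hN0 : (0 : ℝ) < N := by exact_mod_cast hN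
  have hN1 : (1 : ℝ) ≤ N := by exact_mod_cast hN
  set K := ⌊(N : ℝ) ^ η⌋₊ with hKdef
  have hKle : (K : ℝ) ≤ (N : ℝ) ^ η := Nat.floor_le (by positivity)
  have hKlt : (N : ℝ) ^ η < K + 1 := Nat.lt_floor_add_one _
  have hK0 : (0 : ℝ) < K := by linarith
  refine ⟨hN, by exact_mod_cast hK3, fun q hq hqK => ?_, (N : ℝ) ^ (-(η / 16)), by positivity,
    ?_, hNε⟩
  · refine le_trans ?_ (hα q hq)
    have hq0 : (0 : ℝ) < q := by exact_mod_cast hq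
    have hqK' : (q : ℝ) ≤ 6144 * (K : ℝ) ^ 5 := by exact_mod_cast hqK
    rw [div_le_div_iff₀ hN0 (by positivity)]
    have h1 : (K : ℝ) ^ (5 * M + 6) ≤ N := by
      calc (K : ℝ) ^ (5 * M + 6) ≤ ((N : ℝ) ^ η) ^ (5 * M + 6) := by gcongr
        _ = N := by
          rw [hη, one_div]
          exact Real.rpow_inv_natCast_pow hN0.le (by omega)
    rw [div_le_iff₀ hc] at hKc
    calc 3072 * (K : ℝ) ^ 5 * (q : ℝ) ^ M
        ≤ 3072 * (K : ℝ) ^ 5 * (6144 * (K : ℝ) ^ 5) ^ M := by gcongr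
      _ = 3072 * 6144 ^ M * (K : ℝ) ^ (5 * M + 5) := by
          rw [mul_pow, ← pow_mul]
          ring
      _ ≤ K * c * (K : ℝ) ^ (5 * M + 5) := by gcongr
      _ = c * (K : ℝ) ^ (5 * M + 6) := by ring
      _ ≤ c * N := by gcongr
  · have h1 : ((N : ℝ) ^ (-(η / 16))) ^ 8 = (N : ℝ) ^ (-(η / 2)) := by
      rw [← Real.rpow_natCast, ← Real.rpow_mul hN0.le]
      congr 1
      push_cast
      ring
    rw [h1]
    calc (1 : ℝ) ≤ (N : ℝ) ^ (η / 2) := Real.one_le_rpow hN1 (by positivity)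
      _ = (N : ℝ) ^ η * (N : ℝ) ^ (-(η / 2)) := by
          rw [← Real.rpow_add hN0]
          congr 1
          ring
      _ ≤ 2 * K * (N : ℝ) ^ (-(η / 2)) := by
          gcongr
          linarith

lemma exceptionCount_le_self (A : Set ℕ) (T : ℕ) : exceptionCount A T ≤ T := by
  refine (Set.ncard_le_ncard Set.sdiff_subset (Set.finite_Icc 1 T)).trans ?_
  rw [← Finset.coe_Icc, Set.ncard_coe_finset]
  simp

lemma exists_exceptionCount_le_rpow {ε : ℕ → ℝ} {α η : ℝ} (hη : η ≤ 1)
    (h : ∀ᶠ N : ℕ in atTop, GoodLevel ε α ⌊(N : ℝ) ^ η⌋₊ N) :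
    ∃ C : ℝ, ∀ T : ℕ, 1 ≤ T →
      (exceptionCount (quadSet ε α) T : ℝ) ≤ C * (T : ℝ) ^ (1 - η) := by
  obtain ⟨T₀, hT₀⟩ := eventually_atTop.1 h
  refine ⟨8 + T₀, fun T hT => ?_⟩
  have hT1 : (1 : ℝ) ≤ T := by exact_mod_cast hT
  have hpow : 1 ≤ (T : ℝ) ^ (1 - η) := Real.one_le_rpow hT1 (by linarith)
  rcases le_or_gt T₀ T with hle | hlt
  · have hgood := hT₀ T hle
    have hK := hgood.three_le
    have h1 := hgood.exceptionCount_le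
    have h2 : (T : ℝ) ^ η < ⌊(T : ℝ) ^ η⌋₊ + 1 := Nat.lt_floor_add_one _
    set K := ⌊(T : ℝ) ^ η⌋₊
    have hK3 : (3 : ℝ) ≤ K := by exact_mod_cast hK
    have h3 : 4 * (T : ℝ) / K ≤ 8 * (T : ℝ) ^ (1 - η) := by
      rw [div_le_iff₀ (by linarith)]
      calc 4 * (T : ℝ) = 4 * ((T : ℝ) ^ (1 - η) * (T : ℝ) ^ η) := by
            rw [← Real.rpow_add (by linarith)]
            simp
        _ ≤ 4 * ((T : ℝ) ^ (1 - η) * (2 * K)) := by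
            gcongr
            linarith
        _ = 8 * (T : ℝ) ^ (1 - η) * K := by ring
    have h4 : (0 : ℝ) ≤ T₀ * (T : ℝ) ^ (1 - η) := by positivity
    linarith
  · have h1 : (exceptionCount (quadSet ε α) T : ℝ) ≤ T₀ := by
      exact_mod_cast (exceptionCount_le_self _ T).trans hlt.le
    have h2 : (T₀ : ℝ) * 1 ≤ T₀ * (T : ℝ) ^ (1 - η) := by gcongr
    linarith

/-! ### Badly approximable α -/

/-- A set of positive integers whose elements grow at least geometrically has at most
logarithmically many elements up to `T`. -/
lemma card_le_of_lacunary {s : Finset ℕ} {T : ℕ} {κ : ℝ} (hκ : 0 < κ)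
    (hs : ∀ n ∈ s, 1 ≤ n ∧ n ≤ T)
    (hgap : ∀ n ∈ s, ∀ m ∈ s, n < m → (1 + κ) * n ≤ m) :
    (s.card : ℝ) ≤ Real.log T / Real.log (1 + κ) + 1 := by
  have hlog : 0 < Real.log (1 + κ) := Real.log_pos (by linarith)
  have hcard : s.card ≤ (Finset.range (⌊Real.log T / Real.log (1 + κ)⌋₊ + 1)).card := by
    -- Each gap raises the logarithm to base 1 + κ by at least 1, so its floor is injective on s.
    refine Finset.card_le_card_of_injOn (fun n : ℕ => ⌊Real.log n / Real.log (1 + κ)⌋₊) ?_ ?_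
    · intro n hn
      obtain ⟨h1, h2⟩ := hs n hn
      have h1' : (0 : ℝ) < n := by exact_mod_cast h1
      simp only [Finset.coe_range, Set.mem_Iio]
      refine Nat.lt_succ_of_le (Nat.floor_le_floor ?_)
      gcongr
    · have key : ∀ n ∈ s, ∀ m ∈ s, n < m → ⌊Real.log n / Real.log (1 + κ)⌋₊ ≠
          ⌊Real.log m / Real.log (1 + κ)⌋₊ := by
        intro n hn m hm hnm
        have h1 : (1 : ℝ) ≤ n := by exact_mod_cast (hs n hn).1
        have h2 := Real.log_le_log (by positivity) (hgap n hn m hm hnm)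
        rw [Real.log_mul (by positivity) (by positivity)] at h2
        have h3 : Real.log n / Real.log (1 + κ) + 1 ≤ Real.log m / Real.log (1 + κ) := by
          rw [div_add_one hlog.ne']
          gcongr
          linarith
        have h4 := Nat.floor_le_floor h3
        rw [Nat.floor_add_one (div_nonneg (Real.log_nonneg h1) hlog.le)] at h4
        omega
      intro n hn m hm hnm
      rcases lt_trichotomy n m with hlt | heq | hlt
      · exact (key n hn m hm hlt hnm).elim
      · exact heq
      · exact (key m hm n hn hlt hnm.symm).elim
  rw [Finset.card_range] at hcard
  refine (Nat.cast_le.2 hcard).trans ?_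
  push_cast
  have hT : 0 ≤ Real.log T / Real.log (1 + κ) :=
    div_nonneg (Real.log_natCast_nonneg T) hlog.le
  linarith [Nat.floor_le hT]

lemma exists_div_le_nearestIntDist {α : ℝ} (h : IsBadlyApproximable α) :
    ∃ c : ℝ, 0 < c ∧ ∀ q : ℕ, 0 < q → c / (q : ℝ) ≤ nearestIntDist (q * α) := by
  obtain ⟨c, hc, hcq⟩ := h
  refine ⟨c, hc, fun q hq => ?_⟩
  have hq0 : (0 : ℝ) < q := by exact_mod_cast hq
  rw [nearestIntDist_nat_mul_eq α hq]
  calc c / (q : ℝ) = q * (c / (q : ℝ) ^ 2) := by field_simp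
    _ ≤ _ := by
      gcongr
      exact hcq _ _ hq

/-- K and N₀ are chosen before ε, which makes the constant in part (3) uniform in ε. -/
lemma exists_goodLevel_of_bounded_below {α : ℝ} (hα : Irrational α) {ε₀ : ℝ} (hε₀ : 0 < ε₀)
    (K₀ : ℕ) : ∃ K : ℕ, K₀ ≤ K ∧ ∃ N₀ : ℕ, ∀ ε : ℕ → ℝ, (∀ n, ε₀ ≤ ε n) →
      ∀ N, N₀ ≤ N → GoodLevel ε α K N := by
  obtain ⟨K, hK⟩ := exists_nat_ge (max (max 3 K₀) (1 / ε₀ ^ 8) : ℝ)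
  have h1 : (3 : ℝ) ≤ K := ((le_max_left _ _).trans (le_max_left _ _)).trans hK
  have h2 : (K₀ : ℝ) ≤ K := ((le_max_right _ _).trans (le_max_left _ _)).trans hK
  have h3 : 1 / ε₀ ^ 8 ≤ K := (le_max_right _ _).trans hK
  rw [div_le_iff₀ (by positivity)] at h3
  obtain ⟨N₀, hN₀⟩ := eventually_atTop.1
    ((eventually_diophantine hα K).and (eventually_gt_atTop 0))
  refine ⟨K, by exact_mod_cast h2, N₀, fun ε hε N hN => ?_⟩
  exact ⟨(hN₀ N hN).2, by exact_mod_cast h1, (hN₀ N hN).1, ε₀, hε₀.le, by linarith,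
    fun n _ => hε n⟩

lemma exists_exceptionCount_le_log {α : ℝ} (hα : Irrational α) (hbad : IsBadlyApproximable α)
    {ε₀ : ℝ} (hε₀ : 0 < ε₀) :
    ∃ C : ℝ, ∀ ε : ℕ → ℝ, (∀ n, ε₀ ≤ ε n) → ∀ T : ℕ, 2 ≤ T →
      (exceptionCount (quadSet ε α) T : ℝ) ≤ C * Real.log (T : ℝ) := by
  classical
  obtain ⟨c, hc, hcq⟩ := exists_div_le_nearestIntDist hbad
  obtain ⟨K, hK1, N₀, hN₀⟩ := exists_goodLevel_of_bounded_below hα hε₀ 1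
  have hK0 : (0 : ℝ) < K := by exact_mod_cast hK1
  -- Resonances n < m of the same l give c/(2K(m-n)) ≤ 16K²/n, that is, m - n ≥ κn.
  set κ : ℝ := c / (32 * (K : ℝ) ^ 3) with hκdef
  have hκ : 0 < κ := by positivity
  refine ⟨(N₀ + K) / Real.log 2 + K / Real.log (1 + κ), fun ε hε T hT => ?_⟩
  set F : ℕ → Finset ℕ := fun l => (Finset.Icc 1 T).filter fun n : ℕ =>
    nearestIntDist (n * (2 * l * α)) < 8 * (K : ℝ) ^ 2 / n with hF
  have hFcard : ∀ l ∈ Finset.Icc 1 K,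
      ((F l).card : ℝ) ≤ Real.log T / Real.log (1 + κ) + 1 := by
    intro l hl
    rw [Finset.mem_Icc] at hl
    have hl0 : (0 : ℝ) < l := by exact_mod_cast hl.1
    have hlK : (l : ℝ) ≤ K := by exact_mod_cast hl.2
    refine card_le_of_lacunary hκ (fun n hn => ?_) (fun n hn m hm hnm => ?_)
    · exact Finset.mem_Icc.1 (Finset.mem_filter.1 hn).1
    · obtain ⟨hn1, hn2⟩ := Finset.mem_filter.1 hn
      obtain ⟨hm1, hm2⟩ := Finset.mem_filter.1 hm
      have hn0 : (0 : ℝ) < n := by exact_mod_cast (Finset.mem_Icc.1 hn1).1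
      have hnmR : (n : ℝ) < m := by exact_mod_cast hnm
      have hd : (0 : ℝ) < m - n := by linarith
      have h1 := hcq (2 * l * (m - n)) (by
        have := hl.1
        have : 0 < m - n := by omega
        positivity)
      have h2 : ((2 * l * (m - n) : ℕ) : ℝ) = 2 * l * ((m : ℝ) - n) := by
        push_cast [Nat.cast_sub hnm.le]
        ring
      have h3 : 2 * l * ((m : ℝ) - n) * α = m * (2 * l * α) - n * (2 * l * α) := by ring
      rw [h2, h3] at h1
      have h4 := nearestIntDist_sub_le (m * (2 * l * α)) (n * (2 * l * α))
      have h5 : 8 * (K : ℝ) ^ 2 / m ≤ 8 * (K : ℝ) ^ 2 / n := by gcongr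
      have h6 : c / (2 * K * ((m : ℝ) - n)) ≤ c / (2 * l * ((m : ℝ) - n)) := by gcongr
      have h7 : c / (2 * K * ((m : ℝ) - n)) ≤ 16 * (K : ℝ) ^ 2 / n := by
        have : 16 * (K : ℝ) ^ 2 / n = 8 * (K : ℝ) ^ 2 / n + 8 * (K : ℝ) ^ 2 / n := by ring
        linarith
      rw [div_le_div_iff₀ (by positivity) hn0] at h7
      have h8 : κ * n ≤ m - n := by
        rw [hκdef, div_mul_eq_mul_div, div_le_iff₀ (by positivity)]
        linarith
      linarith
  have hsub : Set.Icc 1 T \ kSumset 2 (quadSet ε α) ⊆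
      ((Finset.Icc 1 N₀ ∪ (Finset.Icc 1 K).biUnion F : Finset ℕ) : Set ℕ) := by
    rintro n ⟨⟨hn1, hnT⟩, hn2⟩
    simp only [Finset.coe_union, Set.mem_union, Finset.mem_coe, Finset.mem_Icc,
      Finset.mem_biUnion]
    by_cases hnN : n ≤ N₀
    · exact Or.inl ⟨hn1, hnN⟩
    · obtain ⟨l, hl0, hlK, hl⟩ := (hN₀ ε hε n (not_le.1 hnN).le).exists_nearestIntDist_lt
        le_rfl (Nat.le_mul_of_pos_left n hK1) hn2
      refine Or.inr ⟨l, ⟨hl0, hlK⟩, ?_⟩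
      simp only [hF, Finset.mem_filter, Finset.mem_Icc]
      exact ⟨⟨hn1, hnT⟩, hl⟩
  have hcard : exceptionCount (quadSet ε α) T ≤ N₀ + ∑ l ∈ Finset.Icc 1 K, (F l).card := by
    refine (Set.ncard_le_ncard hsub (Finset.finite_toSet _)).trans ?_
    rw [Set.ncard_coe_finset]
    refine (Finset.card_union_le _ _).trans ?_
    gcongr
    · simp
    · exact Finset.card_biUnion_le
  have hcardR : (exceptionCount (quadSet ε α) T : ℝ) ≤
      N₀ + K * (Real.log T / Real.log (1 + κ) + 1) := by
    refine (Nat.cast_le.2 hcard).trans ?_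
    push_cast
    gcongr
    refine (Finset.sum_le_sum hFcard).trans_eq ?_
    rw [Finset.sum_const, Nat.card_Icc, nsmul_eq_mul, Nat.add_sub_cancel]
  have hlog2 : 0 < Real.log 2 := Real.log_pos one_lt_two
  have hlogT : Real.log 2 ≤ Real.log T := Real.log_le_log two_pos (by exact_mod_cast hT)
  -- The constant terms are absorbed using log T ≥ log 2.
  have h1 : (N₀ + K : ℝ) ≤ (N₀ + K) / Real.log 2 * Real.log T := by
    rw [div_mul_eq_mul_div, le_div_iff₀ hlog2]
    gcongr
  refine hcardR.trans ?_
  have h2 : (K : ℝ) * (Real.log T / Real.log (1 + κ) + 1) =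
      K / Real.log (1 + κ) * Real.log T + K := by ring
  rw [h2, add_mul]
  linarith

end

/-! ### The theorem -/

theorem mainTheorem2 (α : ℝ) (hα : Irrational α) :
    -- slowly decaying `ε`, arbitrary irrational `α`
    (∃ εα : ℕ → ℝ, StrictAnti εα ∧ Tendsto εα atTop (𝓝 0) ∧
      ∀ ε : ℕ → ℝ, (∀ n, εα n ≤ ε n) →
        IsAlmostBasisOfOrder 2 (quadSet ε α) ∧ IsBasisOfOrder 3 (quadSet ε α)) ∧
    -- finite irrationality measure, `ε(n) = n^{-o(1)}`
    (irrationalityMeasure α < ⊤ →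
      ∃ c : ℝ, 0 < c ∧ ∀ ε : ℕ → ℝ, (∀ n, 0 < ε n) →
        Tendsto (fun n : ℕ => Real.log (1 / ε n) / Real.log (n : ℝ)) atTop (𝓝 0) →
          IsAlmostBasisOfOrder 2 (quadSet ε α) ∧ IsBasisOfOrder 3 (quadSet ε α) ∧
          ∃ C : ℝ, ∀ T : ℕ, 1 ≤ T →
            (exceptionCount (quadSet ε α) T : ℝ) ≤ C * (T : ℝ) ^ (1 - c)) ∧
    -- badly approximable `α`, `ε` bounded below
    (IsBadlyApproximable α →
      ∀ ε₀ : ℝ, 0 < ε₀ → ∃ C : ℝ, ∀ ε : ℕ → ℝ, (∀ n, ε₀ ≤ ε n) →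
        IsAlmostBasisOfOrder 2 (quadSet ε α) ∧ IsBasisOfOrder 3 (quadSet ε α) ∧
        ∀ T : ℕ, 2 ≤ T →
          (exceptionCount (quadSet ε α) T : ℝ) ≤ C * Real.log (T : ℝ)) := by
  refine ⟨?_, fun hμ => ?_, fun hbad ε₀ hε₀ => ?_⟩
  · obtain ⟨εα, h1, h2, h3⟩ := exists_strictAnti_goodLevel hα
    exact ⟨εα, h1, h2, fun ε hε => isAlmostBasis_and_isBasis_of_goodLevel (h3 ε hε)⟩
  · obtain ⟨c, hc, M, hcM⟩ := exists_pow_le_nearestIntDist hα hμ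
    refine ⟨1 / (5 * M + 6 : ℕ), by positivity, fun ε hε hlim => ?_⟩
    have hgood := eventually_goodLevel_floor_rpow hc hcM hε hlim
    obtain ⟨h1, h2⟩ := isAlmostBasis_and_isBasis_of_goodLevel (ε := ε) (α := α) fun K₀ => by
      have htop : Tendsto (fun N : ℕ => ⌊(N : ℝ) ^ (1 / (5 * M + 6 : ℕ) : ℝ)⌋₊) atTop atTop :=
        tendsto_nat_floor_atTop.comp
          ((tendsto_rpow_atTop (by positivity)).comp tendsto_natCast_atTop_atTop)
      filter_upwards [hgood, htop.eventually_ge_atTop K₀] with N hN hK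
      exact ⟨_, hK, hN⟩
    refine ⟨h1, h2, exists_exceptionCount_le_rpow ?_ hgood⟩
    rw [div_le_one (by positivity)]
    exact_mod_cast (by omega : 1 ≤ 5 * M + 6)
  · obtain ⟨C, hC⟩ := exists_exceptionCount_le_log hα hbad hε₀
    refine ⟨C, fun ε hε => ?_⟩
    obtain ⟨h1, h2⟩ := isAlmostBasis_and_isBasis_of_goodLevel (ε := ε) (α := α) fun K₀ => by
      obtain ⟨K, hK, N₀, hN₀⟩ := exists_goodLevel_of_bounded_below hα hε₀ K₀
      filter_upwards [eventually_ge_atTop N₀] with N hN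
      exact ⟨K, hK, hN₀ ε hε N hN⟩
    exact ⟨h1, h2, hC ε hε⟩
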